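/- Let $\mathbb K=\mathbb R$ or $\mathbb C$. Let $V$ be a finite-dimensional $\mathbb K$-vector space with a nondegenerate symmetric bilinear form $(\cdot,\cdot)$ (of any signature if $\mathbb K=\mathbb R$), let $Cl(V)$ be its Clifford algebra, with the convention $vu+uv=-2(v,u)1$ for $u,v\in V$, and let $W$ be a $Cl(V)$-module, with action denoted by $c\cdot s$. Let $\mathfrak{so}(V)$ act on $W$ by the spin representation, i.e. through the elements $uv-vu\in Cl(V)$ with $u,v\in V$. Let $\beta$ be a nondegenerate $\mathbb K$-bilinear form on $W$ that is $\mathfrak{so}(V)$-invariant, is symmetric (put $\epsilon=-1$) or skew-symmetric (put $\epsilon=1$), and satisfies $\beta(v\cdot s,t)=\epsilon\,\beta(s,v\cdot t)$ for all $v\in V$ and $s,t\in W$. Let $\mathfrak m=\mathfrak m_{-2}+\mathfrak m_{-1}=V+W$ be the graded Lie algebra in which $V$ is central and the bracket $W\times W\to V$ is determined by $([s,t],v)=\beta(v\cdot s,t)$ for all $s,t\in W$ and $v\in V$. A transitive prolongation of $\mathfrak m$ is a $\mathbb Z$-graded Lie algebra $\mathfrak g=\sum_{p\in\mathbb Z}\mathfrak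 g_p$ over $\mathbb K$ such that every $\mathfrak g_p$ is finite-dimensional; $\mathfrak g_p=0$ for $p<-2$, and the negative part $\mathfrak g_{-2}+\mathfrak g_{-1}$ is identified with $\mathfrak m=\mathfrak m_{-2}+\mathfrak m_{-1}$ as a graded Lie algebra; and, for all $p\ge 0$, if $X\in\mathfrak g_p$ and $[X,\mathfrak g_{-1}]=0$, then $X=0$. It is the maximal transitive prolongation of $\mathfrak m$ if, for every transitive prolongation $\mathfrak g'$ of $\mathfrak m$, there is an injective homomorphism of graded Lie algebras $\mathfrak g'\to\mathfrak g$ that is the identity on $\mathfrak m$. **Theorem 2.5.** Let $\dim V\ge 3$, let $W$ be an irreducible $Cl(V)$-module, and let $\mathfrak g$ be the maximal transitive prolongation of $\mathfrak m=V+W$. Then exactly one of the following two cases occurs: 1. $\mathfrak g_p=0$ for all $p\ge 1$; 2. $\mathfrak g$ is a simple Lie algebra over $\mathbb K$. -/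

import Mathlib

universe u

noncomputable section

/-- The Clifford algebra of `V` for the symmetric bilinear form `B`, with the sign convention
`v * u + u * v = -2 B(v, u)`, i.e. `v * v = -B(v, v)`. -/
abbrev Cl {K V : Type*} [Field K] [AddCommGroup V] [Module K V]
    (B : LinearMap.BilinForm K V) : Type _ :=
  CliffordAlgebra (-(LinearMap.BilinMap.toQuadraticMap B))

/-- Clifford multiplication `v · s` of an element `s` of a `Cl(V)`-module by a vector `v`. -/
def cliffordMul {K V W : Type*} [Field K] [AddCommGroup V] [Module K V]
    (B : LinearMap.BilinForm K V) [AddCommGroup W] [Module (Cl B) W] (v : V) (s : W) : W :=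
  (CliffordAlgebra.ι (-(LinearMap.BilinMap.toQuadraticMap B)) v : Cl B) • s

/-- Clifford multiplication as a `K`-bilinear map `V × W → W`. -/
def cliffordMulₗ {K V W : Type*} [Field K] [AddCommGroup V] [Module K V]
    (B : LinearMap.BilinForm K V) [AddCommGroup W] [Module K W] [Module (Cl B) W]
    [IsScalarTower K (Cl B) W] : V →ₗ[K] W →ₗ[K] W :=
  LinearMap.mk₂ K (cliffordMul B)
    (fun _ _ _ => by simp [cliffordMul, add_smul])
    (fun _ _ _ => by simp [cliffordMul, smul_assoc])
    (fun _ _ _ => by simp [cliffordMul])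
    (fun c v s => by
      simp only [cliffordMul]
      rw [← algebraMap_smul (Cl B) c s, ← algebraMap_smul (Cl B) c (_ • s), smul_smul, smul_smul,
        Algebra.commutes])

/-- The data defining an extended translation algebra `V + W`: a nondegenerate symmetric bilinear
form `B` on `V`, and a nondegenerate bilinear form `β` on the `Cl(V)`-module `W` that is
`so(V)`-invariant, symmetric or skew-symmetric, and satisfies `β(v · s, t) = ε β(s, v · t)`.
Here `so(V)` acts on `W` through its spin representation, i.e. through the commutators
`u v - v u` in `Cl(V)`, for `u, v ∈ V`. -/
structure ExtendedTranslationData {K V : Type*} (W : Type*) [Field K] [AddCommGroup V] [Module K V]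
    (B : LinearMap.BilinForm K V) [AddCommGroup W] [Module K W] [Module (Cl B) W] where
  symm_B : ∀ u v : V, B u v = B v u
  nondegenerate_B : B.Nondegenerate
  /-- the bilinear form on `W` -/
  β : LinearMap.BilinForm K W
  nondegenerate_β : β.Nondegenerate
  /-- the sign attached to `β`: `-1` if `β` is symmetric, `1` if `β` is skew-symmetric -/
  ε : K
  /-- `β` is `so(V)`-invariant -/
  so_invariant : ∀ (u v : V) (s t : W),
    β (cliffordMul B u (cliffordMul B v s) - cliffordMul B v (cliffordMul B u s)) t
      + β s (cliffordMul B u (cliffordMul B v t) - cliffordMul B v (cliffordMul B u t)) = 0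
  symm_or_skew : (ε = -1 ∧ ∀ s t : W, β s t = β t s) ∨ (ε = 1 ∧ ∀ s t : W, β s t = - β t s)
  cliffordMul_adjoint : ∀ (v : V) (s t : W),
    β (cliffordMul B v s) t = ε * β s (cliffordMul B v t)

namespace ExtendedTranslationData

variable {K V W : Type*} [Field K] [AddCommGroup V] [Module K V]
  {B : LinearMap.BilinForm K V} [AddCommGroup W] [Module K W] [Module (Cl B) W]

/-- The bracket `W × W → V`, `([s, t], v) = β(v · s, t)`. -/
def oddBracket [FiniteDimensional K V] [IsScalarTower K (Cl B) W]
    (D : ExtendedTranslationData W B) (s t : W) : V :=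
  (B.toDual D.nondegenerate_B).symm
    ((LinearMap.flip D.β t).comp ((LinearMap.flip (cliffordMulₗ B)) s))

theorem oddBracket_spec [FiniteDimensional K V] [IsScalarTower K (Cl B) W]
    (D : ExtendedTranslationData W B) (s t : W) (v : V) :
    B (D.oddBracket s t) v = D.β (cliffordMul B v s) t := by
  rw [oddBracket, LinearMap.BilinForm.apply_toDual_symm_apply]
  rfl

theorem oddBracket_ext [FiniteDimensional K V] (D : ExtendedTranslationData W B) {x y : V}
    (h : ∀ v, B x v = B y v) : x = y :=
  (B.toDual D.nondegenerate_B).injective (LinearMap.ext h)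

theorem oddBracket_self [CharZero K] [FiniteDimensional K V] [IsScalarTower K (Cl B) W]
    (D : ExtendedTranslationData W B) (s : W) : D.oddBracket s s = 0 := by
  apply D.oddBracket_ext
  intro v
  rw [D.oddBracket_spec, map_zero, LinearMap.zero_apply]
  have h1 := D.cliffordMul_adjoint v s s
  rcases D.symm_or_skew with ⟨h, h2⟩ | ⟨h, h2⟩
  · rw [h, h2 s] at h1
    exact self_eq_neg.mp (by simpa using h1)
  · rw [h, h2 s] at h1
    exact self_eq_neg.mp (by simpa using h1)

/-- The underlying space `V + W` of the extended translation algebra `m(V, W, β)`. -/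
@[nolint unusedArguments]
def Alg {K V W : Type*} [Field K] [AddCommGroup V] [Module K V]
    {B : LinearMap.BilinForm K V} [AddCommGroup W] [Module K W] [Module (Cl B) W]
    (_D : ExtendedTranslationData W B) : Type _ := V × W

variable (D : ExtendedTranslationData W B)

instance : AddCommGroup D.Alg := inferInstanceAs (AddCommGroup (V × W))

instance : Module K D.Alg := inferInstanceAs (Module K (V × W))

/-- The inclusion `V → V + W`. -/
def inV : V →ₗ[K] D.Alg := LinearMap.inl K V W

/-- The inclusion `W → V + W`. -/
def inW : W →ₗ[K] D.Alg := LinearMap.inr K V W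

/-- The projection `V + W → V`. -/
def toV : D.Alg →ₗ[K] V := LinearMap.fst K V W

/-- The projection `V + W → W`. -/
def toW : D.Alg →ₗ[K] W := LinearMap.snd K V W

@[simp] theorem toV_inV (v : V) : D.toV (D.inV v) = v := rfl

@[simp] theorem toW_inV (v : V) : D.toW (D.inV v) = 0 := rfl

@[simp] theorem toV_inW (s : W) : D.toV (D.inW s) = 0 := rfl

@[simp] theorem toW_inW (s : W) : D.toW (D.inW s) = s := rfl

theorem inV_add_inW (x : D.Alg) : D.inV (D.toV x) + D.inW (D.toW x) = x :=
  Prod.ext (add_zero _) (zero_add _)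

section Lie

variable [CharZero K] [FiniteDimensional K V] [IsScalarTower K (Cl B) W]

/-- The Lie bracket of `m(V, W, β)`: `V` is central and `[W, W] ⊆ V`. -/
instance : LieRing D.Alg where
  bracket x y := D.inV (D.oddBracket (D.toW x) (D.toW y))
  add_lie x y z := by
    rw [← map_add]
    congr 1
    apply D.oddBracket_ext
    intro v
    simp [oddBracket_spec, cliffordMul]
  lie_add x y z := by
    rw [← map_add]
    congr 1
    apply D.oddBracket_ext
    intro v
    simp [oddBracket_spec]
  lie_self x := by rw [D.oddBracket_self, map_zero]
  leibniz_lie x y z := by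
    rw [← map_add]
    congr 1
    apply D.oddBracket_ext
    intro v
    simp [oddBracket_spec, cliffordMul]

theorem lie_def (x y : D.Alg) : ⁅x, y⁆ = D.inV (D.oddBracket (D.toW x) (D.toW y)) := rfl

instance : LieAlgebra K D.Alg where
  lie_smul c x y := by
    rw [lie_def, lie_def, ← map_smul]
    congr 1
    apply D.oddBracket_ext
    intro v
    simp [oddBracket_spec]

end Lie

/-- The gradation of `m(V, W, β)`: `m₋₂ = V`, `m₋₁ = W`, and the other components vanish. -/
def grading (p : ℤ) : Submodule K D.Alg :=
  if p = -2 then LinearMap.range D.inV else if p = -1 then LinearMap.range D.inW else ⊥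

theorem grading_neg_two : D.grading (-2) = LinearMap.range D.inV := rfl

theorem grading_neg_one : D.grading (-1) = LinearMap.range D.inW := rfl

theorem inV_mem_grading (v : V) : D.inV v ∈ D.grading (-2) := by
  rw [grading_neg_two]
  exact ⟨v, rfl⟩

theorem inW_mem_grading (s : W) : D.inW s ∈ D.grading (-1) := by
  rw [grading_neg_one]
  exact ⟨s, rfl⟩

theorem grading_of_ne {p : ℤ} (h2 : p ≠ -2) (h1 : p ≠ -1) : D.grading p = ⊥ := by
  simp [grading, h2, h1]

theorem toW_eq_zero_of_mem_grading {p : ℤ} {x : D.Alg} (hx : x ∈ D.grading p) (hp : p ≠ -1) :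
    D.toW x = 0 := by
  by_cases h2 : p = -2
  · subst h2
    obtain ⟨v, rfl⟩ := hx
    simp
  · rw [D.grading_of_ne h2 hp, Submodule.mem_bot] at hx
    rw [hx, map_zero]

/-- `m(V, W, β)` is a graded Lie algebra. -/
instance [CharZero K] [FiniteDimensional K V] [IsScalarTower K (Cl B) W] :
    GradedLieAlgebra D.grading where
  bracket_mem {i j x y} hx hy := by
    by_cases hi : i = -1
    · by_cases hj : j = -1
      · subst hi hj
        exact ⟨_, rfl⟩
      · have : ⁅x, y⁆ = 0 := by
          rw [lie_def, D.toW_eq_zero_of_mem_grading hy hj]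
          convert map_zero D.inV
          apply D.oddBracket_ext
          intro v
          simp [oddBracket_spec]
        rw [this]
        exact zero_mem _
    · have : ⁅x, y⁆ = 0 := by
        rw [lie_def, D.toW_eq_zero_of_mem_grading hx hi]
        convert map_zero D.inV
        apply D.oddBracket_ext
        intro v
        simp [oddBracket_spec, cliffordMul]
      rw [this]
      exact zero_mem _
  toDecomposition := .ofLinearMap D.grading
    ((DirectSum.lof K ℤ (fun p => D.grading p) (-2)).comp
        ((D.inV.codRestrict (D.grading (-2)) D.inV_mem_grading).comp D.toV)
      + (DirectSum.lof K ℤ (fun p => D.grading p) (-1)).comp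
        ((D.inW.codRestrict (D.grading (-1)) D.inW_mem_grading).comp D.toW))
    (by
      ext1 x
      simp only [LinearMap.comp_apply, LinearMap.add_apply, map_add, LinearMap.id_apply,
        DirectSum.coeLinearMap_lof]
      exact D.inV_add_inW x)
    (by
      refine DirectSum.linearMap_ext K fun k => ?_
      ext1 ⟨y, hy⟩
      simp only [LinearMap.comp_apply, LinearMap.add_apply, LinearMap.id_apply,
        DirectSum.coeLinearMap_lof]
      by_cases h2 : k = -2
      · subst h2
        obtain ⟨v, rfl⟩ := hy
        simp only [toV_inV, toW_inV, map_zero, add_zero]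
        rfl
      · by_cases h1 : k = -1
        · subst h1
          obtain ⟨s, rfl⟩ := hy
          simp only [toV_inW, toW_inW, map_zero, zero_add]
          rfl
        · have h0 : y = 0 := by rwa [D.grading_of_ne h2 h1, Submodule.mem_bot] at hy
          subst h0
          have h3 : (⟨0, hy⟩ : D.grading k) = 0 := rfl
          simp [h3])

end ExtendedTranslationData

/-- Let `m = ∑_{p < 0} m_p` be a graded Lie algebra of depth at most two. A graded Lie algebra
`g = ∑ g_p`, together with an injective homomorphism `ι : m → g` of Lie algebras that identifies
`m₋₁`, `m₋₂` with `g₋₁`, `g₋₂`, is a transitive prolongation of `m` if all `g_p` are finite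
dimensional, `g_p = 0` for `p < -2`, and the action of `g_p` on `g₋₁` is faithful for `p ≥ 0`. -/
structure IsTransitiveProlongation {K m g : Type*} [Field K] [LieRing m] [LieAlgebra K m]
    [LieRing g] [LieAlgebra K g] (𝓜 : ℤ → Submodule K m) (𝓖 : ℤ → Submodule K g)
    [GradedLieAlgebra 𝓖] (ι : m →ₗ⁅K⁆ g) : Prop where
  finiteDimensional : ∀ p : ℤ, FiniteDimensional K (𝓖 p)
  injective : Function.Injective ι
  map_neg_one : (𝓜 (-1)).map (ι : m →ₗ[K] g) = 𝓖 (-1)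
  map_neg_two : (𝓜 (-2)).map (ι : m →ₗ[K] g) = 𝓖 (-2)
  eq_bot : ∀ p : ℤ, p < -2 → 𝓖 p = ⊥
  transitive : ∀ p : ℤ, 0 ≤ p → ∀ x ∈ 𝓖 p, (∀ y ∈ 𝓖 (-1), ⁅x, y⁆ = 0) → x = 0

/-- A transitive prolongation `(g, ι)` of `m` is maximal if every transitive prolongation
`(g', ι')` of `m` embeds into it, by an injective homomorphism of graded Lie algebras that is the
identity on `m`. -/
structure IsMaximalTransitiveProlongation {K : Type*} {m g : Type u} [Field K] [LieRing m]
    [LieAlgebra K m] [LieRing g] [LieAlgebra K g] (𝓜 : ℤ → Submodule K m)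
    (𝓖 : ℤ → Submodule K g) [GradedLieAlgebra 𝓖] (ι : m →ₗ⁅K⁆ g) : Prop
    extends IsTransitiveProlongation 𝓜 𝓖 ι where
  maximal : ∀ (g' : Type u) [LieRing g'] [LieAlgebra K g'] (𝓖' : ℤ → Submodule K g')
    [GradedLieAlgebra 𝓖'] (ι' : m →ₗ⁅K⁆ g'), IsTransitiveProlongation 𝓜 𝓖' ι' →
    ∃ φ : g' →ₗ⁅K⁆ g, Function.Injective φ ∧ (∀ p : ℤ, ∀ x ∈ 𝓖' p, φ x ∈ 𝓖 p) ∧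
      ∀ x : m, φ (ι' x) = ι x

end

noncomputable section

/-! A trace argument shows that `g₀` acts on `V` by conformal maps (`exists_conformal_factor`).
Hence, for `X ∈ g₁`, polarising the conformality of all `[X, s]` forces `X` to act on `V` as `v ↦ v
· w` for some `w ∈ W` (`exists_lie_inV_eq`), and `X` is determined by this action
(`eq_zero_of_lie_inV_one`). The same rigidity gives `g₃ = 0`, so `g` is finite-dimensional.

Let `S ⊆ W` be the space of all such `w` (`spinorSubmodule`). Clifford multiplication by an
anisotropic `x` extends to a graded automorphism of `m`, with a multiple of a reflection on `V`.
Maximality extends its inverse to `g`, so `S` is stable under `x`, and hence is a `Cl(V)`-submodule.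
By irreducibility `S` is `0` or `W`.

If `S = 0`, then `g₁ = 0` and everything above vanishes by transitivity; `V` is then a proper
nonzero ideal, so the cases exclude each other. If `S = W`, every nonzero ideal meets `V`, then
contains `V`, then `W`. As `[W, W] ≠ 0`, no nonzero ideal is abelian, so `g` is semisimple; as any
two nonzero ideals share `V`, it is simple. -/

theorem eq_zero_of_eq_neg_of_charZero (K : Type*) {W : Type*} [Field K] [CharZero K]
    [AddCommGroup W] [Module K W] {s : W} (h : s = -s) : s = 0 := by
  have h1 : (2 : K) • s = 0 := by rw [two_smul, ← eq_neg_iff_add_eq_zero]; exact h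
  exact (smul_eq_zero.mp h1).resolve_left two_ne_zero

/-! ### Linear algebra of Clifford actions. -/

section CliffordMap

variable {K V W : Type*} [Field K] [AddCommGroup V] [Module K V] [AddCommGroup W] [Module K W]

/-- `γ` satisfies the Clifford relations `γ(u) γ(v) + γ(v) γ(u) = -2 B(u, v)`. -/
def IsCliffordMap (B : LinearMap.BilinForm K V) (γ : V →ₗ[K] Module.End K W) : Prop :=
  ∀ (u v : V) (s : W), γ u (γ v s) + γ v (γ u s) = (-2 * B u v) • s

namespace IsCliffordMap

variable {B : LinearMap.BilinForm K V} {γ : V →ₗ[K] Module.End K W}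

theorem anticomm (h : IsCliffordMap B γ) {u v : V} (huv : B u v = 0) (s : W) :
    γ u (γ v s) = - γ v (γ u s) := by
  have := h u v s
  rw [huv, mul_zero, zero_smul] at this
  exact eq_neg_of_add_eq_zero_left this

theorem apply_apply_self [CharZero K] (h : IsCliffordMap B γ) (v : V) (s : W) :
    γ v (γ v s) = -(B v v • s) := by
  have h1 := h v v s
  rw [← two_smul K, mul_smul, neg_smul, ← smul_neg] at h1
  rw [smul_right_injective W (two_ne_zero (α := K)) h1]

theorem eq_zero_of_apply_eq_zero [CharZero K] (h : IsCliffordMap B γ) {v : V} (hv : B v v ≠ 0)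
    {s : W} (hs : γ v s = 0) : s = 0 := by
  have h1 := h.apply_apply_self v s
  rw [hs, map_zero, eq_comm, neg_eq_zero] at h1
  exact (smul_eq_zero.mp h1).resolve_left hv

theorem injective_apply [CharZero K] (h : IsCliffordMap B γ) {v : V} (hv : B v v ≠ 0) :
    Function.Injective (γ v) :=
  (injective_iff_map_eq_zero _).mpr fun _ => h.eq_zero_of_apply_eq_zero hv

theorem trace_mul [CharZero K] [FiniteDimensional K W] (h : IsCliffordMap B γ) (u v : V) :
    LinearMap.trace K W (γ u * γ v) = -(B u v * Module.finrank K W) := by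
  have h1 : γ u * γ v + γ v * γ u = (-2 * B u v) • 1 := LinearMap.ext (h u v)
  have h2 := congrArg (LinearMap.trace K W) h1
  rw [map_add, LinearMap.trace_mul_comm K (γ v), map_smul, LinearMap.trace_one, smul_eq_mul,
    ← two_mul] at h2
  exact mul_left_cancel₀ (two_ne_zero (α := K)) (h2.trans (by ring))

theorem eq_zero_of_map_eq_zero [CharZero K] [Nontrivial W] (hB : B.Nondegenerate)
    (h : IsCliffordMap B γ) {v : V} (hv : ∀ s, γ v s = 0) : v = 0 := by
  obtain ⟨s, hs⟩ := exists_ne (0 : W)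
  refine hB.1 v fun u => ?_
  have h1 := h v u s
  rw [hv, hv, map_zero, add_zero, eq_comm] at h1
  simpa using (smul_eq_zero.mp h1).resolve_right hs

/-- If `γ(u) γ(x) = 0`, then `u` and `x` are linearly dependent. -/
theorem smul_eq_smul_of_comp_eq_zero [CharZero K] [Nontrivial W] (hB : B.Nondegenerate)
    (h : IsCliffordMap B γ) {u x : V} (hux : ∀ s, γ u (γ x s) = 0) (z : V) :
    B u z • x = B x z • u := by
  rw [← sub_eq_zero]
  refine h.eq_zero_of_map_eq_zero hB fun s => ?_
  -- Both relations evaluate the action of `u z x`, using `u x = 0`: one gives `-2 B(u, z) x`, the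
  -- other `-2 B(x, z) u`.
  have h2 := h u z (γ x s)
  have h3 := congrArg (γ u) (h x z s)
  rw [map_add, hux, zero_add, map_smul] at h3
  rw [hux, map_zero, add_zero, h3, mul_smul, mul_smul] at h2
  have h4 := smul_right_injective W (show (-2 : K) ≠ 0 by simp) h2
  rw [map_sub, map_smul, map_smul, LinearMap.sub_apply, LinearMap.smul_apply,
    LinearMap.smul_apply, h4, sub_self]

/-- An endomorphism that is skew for all the forms `β(γ(v) s, t)` commutes with the even part of
the Clifford algebra. -/
theorem comm_of_skew [CharZero K] [FiniteDimensional K W] (h : IsCliffordMap B γ)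
    {β : LinearMap.BilinForm K W} (hβ : β.Nondegenerate) {b : Module.End K W}
    (hb : ∀ v s t, β (γ v (b s)) t + β (γ v s) (b t) = 0) {u : V} (hu : B u u ≠ 0) (v : V)
    (s : W) : b (γ u (γ v s)) = γ u (γ v (b s)) := by
  set b' := β.leftAdjointOfNondegenerate hβ b
  have hb' : ∀ x y, β (b' x) y = β x (b y) := β.isAdjointPairLeftAdjointOfNondegenerate hβ b
  -- Passing one vector turns `b` into `-b'`; passing a second turns it back into `b`.
  have key : ∀ v s, γ v (b s) = -(b' (γ v s)) := by
    intro v s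
    rw [← sub_eq_zero]
    refine hβ.1 _ fun t => ?_
    rw [sub_neg_eq_add, map_add, LinearMap.add_apply, hb']
    exact hb v s t
  apply h.injective_apply hu
  rw [h.apply_apply_self u, key, key, h.apply_apply_self u, map_neg, map_smul, smul_neg]

/-- A symmetric bilinear map `F : W × W → W` such that all the maps `F(s, ·)` are skew for all the
forms `β(γ(v) s, t)` vanishes, if `V` contains three orthogonal anisotropic vectors. -/
theorem eq_zero_of_symm_of_skew [CharZero K] [FiniteDimensional K W] (h : IsCliffordMap B γ)
    (hs : ∀ u v, B u v = B v u)
    {β : LinearMap.BilinForm K W} (hβ : β.Nondegenerate) {F : W →ₗ[K] W →ₗ[K] W}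
    (hF : ∀ s t, F s t = F t s)
    (hF' : ∀ s v t u, β (γ v (F s t)) u + β (γ v t) (F s u) = 0)
    {x y z : V} (hx : B x x ≠ 0) (hy : B y y ≠ 0) (hz : B z z ≠ 0) (hxy : B x y = 0)
    (hxz : B x z = 0) (hyz : B y z = 0) : F = 0 := by
  have c2 : ∀ {u : V}, B u u ≠ 0 → ∀ v s t, F s (γ u (γ v t)) = γ u (γ v (F s t)) :=
    fun hu v s t => h.comm_of_skew hβ (hF' s) hu v t
  have c1 : ∀ {u : V}, B u u ≠ 0 → ∀ v s t, F (γ u (γ v s)) t = γ u (γ v (F s t)) := by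
    intro u hu v s t
    rw [hF, c2 hu, hF]
  ext s t
  -- Even elements can be pulled out of either argument, in either order. But `xy` and `yz`
  -- anticommute, so `F s t` is killed by an invertible element.
  have e1 : F (γ x (γ y s)) (γ y (γ z t)) = γ x (γ y (γ y (γ z (F s t)))) := by
    rw [c1 hx, c2 hy]
  have e2 : F (γ x (γ y s)) (γ y (γ z t)) = γ y (γ z (γ x (γ y (F s t)))) := by
    rw [c2 hy, c1 hx]
  rw [e2, h.apply_apply_self, h.anticomm ((hs z x).trans hxz),
    h.anticomm ((hs z y).trans hyz)] at e1
  simp only [map_neg, neg_neg, h.anticomm ((hs y x).trans hxy), h.apply_apply_self, map_smul] at e1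
  have e3 : B y y • γ x (γ z (F s t)) = 0 := by
    apply eq_zero_of_eq_neg_of_charZero K
    simpa using e1
  exact h.eq_zero_of_apply_eq_zero hz (h.eq_zero_of_apply_eq_zero hx
    ((smul_eq_zero.mp e3).resolve_left hy))

/-- A linear map `D : V → W` such that `β(γ(v) D(v), s)` is a multiple of `B(v, v)` for all `s` is
of the form `v ↦ γ(v) w`. -/
theorem exists_eq_apply_of_conformal [CharZero K] (h : IsCliffordMap B γ)
    {β : LinearMap.BilinForm K W} (hβ : β.Nondegenerate) {D : V →ₗ[K] W}
    (hD : ∀ s, ∃ c : K, ∀ v, β (γ v (D v)) s = c * B v v) {x : V} (hx : B x x ≠ 0) :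
    ∃ w, ∀ v, D v = γ v w := by
  set w := (B x x)⁻¹ • γ x (D x) with hw
  -- The value at `v = x` determines the factor `c` as `β(w, s)`.
  have h1 : ∀ v, γ v (D v) = B v v • w := by
    intro v
    rw [← sub_eq_zero]
    refine hβ.1 _ fun s => ?_
    obtain ⟨c, hc⟩ := hD s
    rw [map_sub, LinearMap.sub_apply, hc, hw]
    simp only [map_smul, LinearMap.smul_apply, hc, smul_eq_mul]
    field_simp
    ring
  have h2 : ∀ v, γ v (D v + γ v w) = 0 := by
    intro v
    rw [map_add, h1, h.apply_apply_self, add_neg_cancel]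
  have hDx : D x + γ x w = 0 := h.eq_zero_of_apply_eq_zero hx (h2 x)
  refine ⟨-w, fun v => ?_⟩
  rw [map_neg, ← add_eq_zero_iff_eq_neg]
  apply h.eq_zero_of_apply_eq_zero hx
  -- If `v` is isotropic, `γ v` cannot be cancelled; polarising with `x` replaces it by the
  -- injective `γ x`.
  have h3 := h2 (x + v)
  rw [show D (x + v) + γ (x + v) w = (D x + γ x w) + (D v + γ v w) by
    simp only [map_add, LinearMap.add_apply]; abel, hDx, zero_add, map_add γ,
    LinearMap.add_apply, h2, add_zero] at h3
  exact h3

/-- If `γ(u) f(v) = γ(v) f(u)` for all `u` and `v`, then `f = 0`, if `V` contains three orthogonal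
anisotropic vectors. -/
theorem eq_zero_of_apply_comm [CharZero K] (h : IsCliffordMap B γ) (hs : ∀ u v, B u v = B v u)
    {f : V → W} (hf : ∀ u v, γ u (f v) = γ v (f u))
    {x y z : V} (hx : B x x ≠ 0) (hy : B y y ≠ 0) (hz : B z z ≠ 0) (hxy : B x y = 0)
    (hxz : B x z = 0) (hyz : B y z = 0) (v : V) : f v = 0 := by
  -- Alternating the symmetry of `γ(u) f(v)` with anticommutation returns to the same expression
  -- with the opposite sign.
  have key : γ x (γ y (γ z (f x))) = -γ x (γ y (γ z (f x))) := by
    calc γ x (γ y (γ z (f x))) = γ x (γ y (γ x (f z))) := by rw [hf z x]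
      _ = B x x • γ y (f z) := by
        rw [h.anticomm ((hs y x).trans hxy), map_neg, h.apply_apply_self, neg_neg]
      _ = B x x • γ z (f y) := by rw [hf]
      _ = γ x (γ z (γ x (f y))) := by
        rw [h.anticomm ((hs z x).trans hxz), map_neg, h.apply_apply_self, neg_neg]
      _ = γ x (γ z (γ y (f x))) := by rw [hf x y]
      _ = _ := by rw [h.anticomm ((hs z y).trans hyz), map_neg]
  have h0 : f x = 0 := h.eq_zero_of_apply_eq_zero hz (h.eq_zero_of_apply_eq_zero hy
    (h.eq_zero_of_apply_eq_zero hx (eq_zero_of_eq_neg_of_charZero K key)))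
  apply h.eq_zero_of_apply_eq_zero hx
  rw [hf, h0, map_zero]

end IsCliffordMap

theorem exists_orthogonal_basis_anisotropic [CharZero K] [FiniteDimensional K V]
    {B : LinearMap.BilinForm K V} (hB : B.Nondegenerate) (hs : ∀ u v, B u v = B v u) :
    ∃ e : Module.Basis (Fin (Module.finrank K V)) K V,
      (∀ i j, i ≠ j → B (e i) (e j) = 0) ∧ ∀ i, B (e i) (e i) ≠ 0 := by
  have : Invertible (2 : K) := invertibleOfNonzero two_ne_zero
  obtain ⟨e, he⟩ := LinearMap.BilinForm.exists_orthogonal_basis (B := B) ⟨hs⟩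
  exact ⟨e, fun i j hij => he hij, fun i => he.not_isOrtho_basis_self_of_separatingLeft hB.1 i⟩

theorem exists_orthogonal_triple [CharZero K] [FiniteDimensional K V]
    {B : LinearMap.BilinForm K V} (hB : B.Nondegenerate) (hs : ∀ u v, B u v = B v u)
    (hV : 3 ≤ Module.finrank K V) : ∃ x y z : V, B x x ≠ 0 ∧ B y y ≠ 0 ∧
      B z z ≠ 0 ∧ B x y = 0 ∧ B x z = 0 ∧ B y z = 0 := by
  obtain ⟨e, he, he'⟩ := exists_orthogonal_basis_anisotropic hB hs
  exact ⟨e ⟨0, by lia⟩, e ⟨1, by lia⟩, e ⟨2, by lia⟩, he' _, he' _, he' _, he _ _ (by simp),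
    he _ _ (by simp), he _ _ (by simp)⟩

end CliffordMap

/-! ### Conformality of derivations of degree zero. -/

namespace ExtendedTranslationData

variable {K V W : Type*} [Field K] [AddCommGroup V] [Module K V]
  {B : LinearMap.BilinForm K V} [AddCommGroup W] [Module K W] [Module (Cl B) W]
  [IsScalarTower K (Cl B) W] (D : ExtendedTranslationData W B)

theorem isCliffordMap (D : ExtendedTranslationData W B) :
    IsCliffordMap B (cliffordMulₗ B (W := W)) := by
  intro u v s
  change (CliffordAlgebra.ι (-(LinearMap.BilinMap.toQuadraticMap B)) u : Cl B) •
      (CliffordAlgebra.ι (-(LinearMap.BilinMap.toQuadraticMap B)) v : Cl B) • s +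
    (CliffordAlgebra.ι (-(LinearMap.BilinMap.toQuadraticMap B)) v : Cl B) •
      (CliffordAlgebra.ι (-(LinearMap.BilinMap.toQuadraticMap B)) u : Cl B) • s = _
  rw [smul_smul, smul_smul, ← add_smul, CliffordAlgebra.ι_mul_ι_add_swap, algebraMap_smul]
  congr 1
  simp only [QuadraticMap.polar, neg_apply, LinearMap.BilinMap.toQuadraticMap_apply,
    map_add, LinearMap.add_apply, D.symm_B v u]
  ring

theorem oddBracket_apply [FiniteDimensional K V] (s t : W) (v : V) :
    B (D.oddBracket s t) v = D.β (cliffordMulₗ B v s) t := D.oddBracket_spec s t v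

/-- A derivation of degree zero of `m(V, W, β)` acts on `V` by a conformal transformation. -/
theorem exists_conformal_factor [CharZero K] [FiniteDimensional K V] [FiniteDimensional K W]
    [Nontrivial W] (a : V →ₗ[K] V) (b : W →ₗ[K] W)
    (hab : ∀ s t, a (D.oddBracket s t) = D.oddBracket (b s) t + D.oddBracket s (b t)) :
    ∃ c : K, ∀ v, B (a v) v = c * B v v := by
  have hs := D.symm_B
  have hγ := D.isCliffordMap
  set γ : V →ₗ[K] Module.End K W := cliffordMulₗ B
  set a' := B.leftAdjointOfNondegenerate D.nondegenerate_B a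
  have ha' : ∀ x y, B (a' x) y = B x (a y) :=
    B.isAdjointPairLeftAdjointOfNondegenerate D.nondegenerate_B a
  set b' := D.β.leftAdjointOfNondegenerate D.nondegenerate_β b
  have hb' : ∀ x y, D.β (b' x) y = D.β x (b y) :=
    D.β.isAdjointPairLeftAdjointOfNondegenerate D.nondegenerate_β b
  have key : ∀ v, γ v * b + b' * γ v = γ (a' v) := by
    intro v
    ext s
    rw [← sub_eq_zero]
    refine D.nondegenerate_β.1 _ fun t => ?_
    have h1 := congrArg (fun x => B x v) (hab s t)
    simp only [map_add, LinearMap.add_apply, oddBracket_apply] at h1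
    rw [hs, ← ha', hs, oddBracket_apply] at h1
    rw [map_sub, LinearMap.sub_apply, LinearMap.add_apply, map_add, LinearMap.add_apply,
      Module.End.mul_apply, Module.End.mul_apply, hb']
    exact sub_eq_zero.mpr h1.symm
  have hN : (Module.finrank K W : K) ≠ 0 := Nat.cast_ne_zero.mpr Module.finrank_pos.ne'
  refine ⟨(LinearMap.trace K W b + LinearMap.trace K W b') / Module.finrank K W, fun v => ?_⟩
  -- Multiplying by `γ v` and taking traces, the left side becomes a multiple of `B(v, v)` and the
  -- right side a multiple of `B(v, a' v) = B(a v, v)`.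
  have h1 := congrArg (fun f => LinearMap.trace K W (γ v * f)) (key v)
  have h2 : γ v * γ v = -(B v v) • (1 : Module.End K W) := by
    ext s
    simpa using hγ.apply_apply_self v s
  rw [mul_add, map_add, ← mul_assoc, h2, ← mul_assoc, LinearMap.trace_mul_comm K (γ v * b'), ← mul_assoc,
    h2, smul_mul_assoc, smul_mul_assoc, one_mul, one_mul, map_smul, map_smul, hγ.trace_mul,
    smul_eq_mul, smul_eq_mul, hs v (a' v), ha', hs v (a v)] at h1
  field_simp
  linear_combination h1

end ExtendedTranslationData

end

/-! ### Structure of a transitive prolongation, degree by degree. -/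

noncomputable section

theorem GradedLieAlgebra.lie_mem {K g : Type*} [CommRing K] [LieRing g] [LieAlgebra K g]
    {𝓖 : ℤ → Submodule K g} [GradedLieAlgebra 𝓖] {i j k : ℤ} {x y : g} (hx : x ∈ 𝓖 i)
    (hy : y ∈ 𝓖 j) (hk : i + j = k) : ⁅x, y⁆ ∈ 𝓖 k :=
  hk ▸ SetLike.GradedBracket.bracket_mem hx hy

namespace IsTransitiveProlongation

open ExtendedTranslationData GradedLieAlgebra

variable {K V W g : Type*} [Field K] [CharZero K] [AddCommGroup V] [Module K V]
  [FiniteDimensional K V] {B : LinearMap.BilinForm K V} [AddCommGroup W] [Module K W]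
  [Module (Cl B) W] [IsScalarTower K (Cl B) W] {D : ExtendedTranslationData W B}
  [LieRing g] [LieAlgebra K g] {𝓖 : ℤ → Submodule K g} [GradedLieAlgebra 𝓖]
  {ι : D.Alg →ₗ⁅K⁆ g}

theorem lie_inW_inW (s t : W) : ⁅ι (D.inW s), ι (D.inW t)⁆ = ι (D.inV (D.oddBracket s t)) := by
  rw [← LieHom.map_lie, lie_def, toW_inW, toW_inW]

theorem lie_inV (v : V) (x : D.Alg) : ⁅ι (D.inV v), ι x⁆ = 0 := by
  have h : D.oddBracket 0 (D.toW x) = 0 := D.oddBracket_ext fun v => by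
    simp [oddBracket_apply]
  rw [← LieHom.map_lie, lie_def, toW_inV, h, map_zero, map_zero]

theorem lie_inV_right (v : V) (x : D.Alg) : ⁅ι x, ι (D.inV v)⁆ = 0 := by
  rw [← lie_skew, lie_inV, neg_zero]

theorem inW_mem (h : IsTransitiveProlongation D.grading 𝓖 ι) (s : W) : ι (D.inW s) ∈ 𝓖 (-1) := by
  rw [← h.map_neg_one]
  exact ⟨_, D.inW_mem_grading s, rfl⟩

theorem inV_mem (h : IsTransitiveProlongation D.grading 𝓖 ι) (v : V) : ι (D.inV v) ∈ 𝓖 (-2) := by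
  rw [← h.map_neg_two]
  exact ⟨_, D.inV_mem_grading v, rfl⟩

theorem exists_inW (h : IsTransitiveProlongation D.grading 𝓖 ι) {x : g} (hx : x ∈ 𝓖 (-1)) :
    ∃ s, ι (D.inW s) = x := by
  rw [← h.map_neg_one] at hx
  obtain ⟨_, ⟨s, rfl⟩, rfl⟩ := hx
  exact ⟨s, rfl⟩

theorem exists_inV (h : IsTransitiveProlongation D.grading 𝓖 ι) {x : g} (hx : x ∈ 𝓖 (-2)) :
    ∃ v, ι (D.inV v) = x := by
  rw [← h.map_neg_two] at hx
  obtain ⟨_, ⟨s, rfl⟩, rfl⟩ := hx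
  exact ⟨s, rfl⟩

theorem inW_injective (h : IsTransitiveProlongation D.grading 𝓖 ι) :
    Function.Injective fun s => ι (D.inW s) :=
  h.injective.comp LinearMap.inr_injective

theorem inV_injective (h : IsTransitiveProlongation D.grading 𝓖 ι) :
    Function.Injective fun v => ι (D.inV v) :=
  h.injective.comp LinearMap.inl_injective

/-- Lets brackets that land in `g₋₁` be read as linear maps into `W`. -/
theorem exists_proj_inW (h : IsTransitiveProlongation D.grading 𝓖 ι) :
    ∃ q : g →ₗ[K] W, ∀ x ∈ 𝓖 (-1), ι (D.inW (q x)) = x := by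
  obtain ⟨q, hq⟩ := LinearMap.exists_leftInverse_of_injective ((ι : D.Alg →ₗ[K] g).comp D.inW)
    (LinearMap.ker_eq_bot.mpr h.inW_injective)
  refine ⟨q, fun x hx => ?_⟩
  obtain ⟨s, rfl⟩ := h.exists_inW hx
  exact congrArg (fun s => ι (D.inW s)) (LinearMap.congr_fun hq s)

theorem exists_proj_inV (h : IsTransitiveProlongation D.grading 𝓖 ι) :
    ∃ q : g →ₗ[K] V, ∀ x ∈ 𝓖 (-2), ι (D.inV (q x)) = x := by
  obtain ⟨q, hq⟩ := LinearMap.exists_leftInverse_of_injective ((ι : D.Alg →ₗ[K] g).comp D.inV)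
    (LinearMap.ker_eq_bot.mpr h.inV_injective)
  refine ⟨q, fun x hx => ?_⟩
  obtain ⟨s, rfl⟩ := h.exists_inV hx
  exact congrArg (fun s => ι (D.inV s)) (LinearMap.congr_fun hq s)

theorem finiteDimensional_W (h : IsTransitiveProlongation D.grading 𝓖 ι) :
    FiniteDimensional K W := by
  have := h.finiteDimensional (-1)
  exact FiniteDimensional.of_injective
    (LinearMap.codRestrict (𝓖 (-1)) ((ι : D.Alg →ₗ[K] g).comp D.inW) h.inW_mem)
    fun s t hst => h.inW_injective (congrArg Subtype.val hst)

/-- An element of degree zero acts on `V` by a conformal transformation. -/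
theorem exists_conformal_factor [Nontrivial W] (h : IsTransitiveProlongation D.grading 𝓖 ι)
    {A : g} (hA : A ∈ 𝓖 0) {a : V → V} (ha : ∀ v, ⁅A, ι (D.inV v)⁆ = ι (D.inV (a v))) :
    ∃ c : K, ∀ v, B (a v) v = c * B v v := by
  have := h.finiteDimensional_W
  obtain ⟨p, hp⟩ := h.exists_proj_inV
  obtain ⟨q, hq⟩ := h.exists_proj_inW
  let adA : g →ₗ[K] g := LieAlgebra.ad K g A
  let a' : V →ₗ[K] V := p.comp (adA.comp ((ι : D.Alg →ₗ[K] g).comp D.inV))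
  let b' : W →ₗ[K] W := q.comp (adA.comp ((ι : D.Alg →ₗ[K] g).comp D.inW))
  have ha' : ∀ v, ι (D.inV (a' v)) = ⁅A, ι (D.inV v)⁆ := fun v =>
    hp _ (lie_mem hA (h.inV_mem v) (zero_add _))
  have hb' : ∀ s, ι (D.inW (b' s)) = ⁅A, ι (D.inW s)⁆ := fun s =>
    hq _ (lie_mem hA (h.inW_mem s) (zero_add _))
  obtain ⟨c, hc⟩ := D.exists_conformal_factor a' b' fun s t => h.inV_injective <| by
    simp only [map_add]
    rw [ha', ← lie_inW_inW, ← lie_inW_inW, ← lie_inW_inW, hb', hb', leibniz_lie]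
  refine ⟨c, fun v => ?_⟩
  rw [← hc, h.inV_injective ((ha v).symm.trans (ha' v).symm)]

/-- An element of degree one acts on `V` by Clifford multiplication `v ↦ v · w` on some `w ∈ W`. -/
theorem exists_lie_inV_eq [Nontrivial W] [Nontrivial V]
    (h : IsTransitiveProlongation D.grading 𝓖 ι) {X : g} (hX : X ∈ 𝓖 1) :
    ∃ w, ∀ v, ⁅X, ι (D.inV v)⁆ = ι (D.inW (cliffordMulₗ B v w)) := by
  obtain ⟨q, hq⟩ := h.exists_proj_inW
  let adX : g →ₗ[K] g := LieAlgebra.ad K g X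
  let d : V →ₗ[K] W := q.comp (adX.comp ((ι : D.Alg →ₗ[K] g).comp D.inV))
  have hd : ∀ v, ι (D.inW (d v)) = ⁅X, ι (D.inV v)⁆ := fun v =>
    hq _ (lie_mem hX (h.inV_mem v) (by norm_num))
  obtain ⟨e, -, he⟩ := exists_orthogonal_basis_anisotropic D.nondegenerate_B D.symm_B
  -- Since `s` commutes with `V`, the degree-zero element `[X, s]` acts on `V` by `v ↦ [d(v), s]`,
  -- and its conformality is the hypothesis on `d`.
  obtain ⟨w, hw⟩ := D.isCliffordMap.exists_eq_apply_of_conformal D.nondegenerate_β (D := d)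
    (fun s => by
      obtain ⟨c, hc⟩ := h.exists_conformal_factor (A := ⁅X, ι (D.inW s)⁆)
        (a := fun v => D.oddBracket (d v) s) (lie_mem hX (h.inW_mem s) (by norm_num)) (fun v => by
          rw [lie_lie, lie_inV_right, lie_zero, zero_sub, lie_skew, ← hd, lie_inW_inW])
      refine ⟨c, fun v => ?_⟩
      rw [← hc, oddBracket_apply]) (he ⟨0, Module.finrank_pos⟩)
  exact ⟨w, fun v => by rw [← hd, hw]⟩

/-- The transitivity condition, extended to degree `-1`. -/
theorem eq_zero_of_lie_inW [Nontrivial V] (h : IsTransitiveProlongation D.grading 𝓖 ι)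
    {p : ℤ} (hp : -1 ≤ p) {x : g} (hx : x ∈ 𝓖 p) (hx' : ∀ t, ⁅x, ι (D.inW t)⁆ = 0) : x = 0 := by
  rcases hp.eq_or_lt with rfl | hp
  · obtain ⟨s, rfl⟩ := h.exists_inW hx
    obtain ⟨e, -, he⟩ := exists_orthogonal_basis_anisotropic D.nondegenerate_B D.symm_B
    suffices s = 0 by rw [this, map_zero, map_zero]
    refine D.isCliffordMap.eq_zero_of_apply_eq_zero (he ⟨0, Module.finrank_pos⟩)
      (D.nondegenerate_β.1 _ fun t => ?_)
    have h1 := hx' t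
    rw [lie_inW_inW] at h1
    have h2 : D.oddBracket s t = 0 := h.inV_injective (h1.trans (by simp))
    rw [← oddBracket_apply, h2, map_zero, LinearMap.zero_apply]
  · refine h.transitive p hp x hx fun y hy => ?_
    obtain ⟨t, rfl⟩ := h.exists_inW hy
    exact hx' t

/-- If `X` commutes with `V`, then so does `[X, s]` for all `s ∈ W`. -/
theorem lie_lie_inV_eq_zero {X : g} (hX : ∀ v, ⁅X, ι (D.inV v)⁆ = 0) (s : W) (v : V) :
    ⁅⁅X, ι (D.inW s)⁆, ι (D.inV v)⁆ = 0 := by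
  rw [lie_lie, lie_inV_right, hX, lie_zero, lie_zero, sub_zero]

/-- Put `F(s, t) = [[X, s], t]`. It is symmetric because `X` kills `[s, t] ∈ V`, and each `F(s, ·)`
is skew because `[X, s]` is a derivation that kills `V`. Such an `F` vanishes, and transitivity
applied twice gives `X = 0`. -/
theorem eq_zero_of_lie_inV_one (h : IsTransitiveProlongation D.grading 𝓖 ι)
    (hV : 3 ≤ Module.finrank K V) {X : g} (hX : X ∈ 𝓖 1) (hX' : ∀ v, ⁅X, ι (D.inV v)⁆ = 0) :
    X = 0 := by
  have : Nontrivial V := Module.nontrivial_of_finrank_pos (R := K) (by lia)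
  have := h.finiteDimensional_W
  obtain ⟨x, y, z, hx, hy, hz, hxy, hxz, hyz⟩ := exists_orthogonal_triple D.nondegenerate_B D.symm_B hV
  obtain ⟨q, hq⟩ := h.exists_proj_inW
  let j : W →ₗ[K] g := (ι : D.Alg →ₗ[K] g).comp D.inW
  let adX : g →ₗ[K] g := LieAlgebra.ad K g X
  let F : W →ₗ[K] W →ₗ[K] W :=
    (((LieAlgebra.ad K g : g →ₗ[K] Module.End K g).comp (adX.comp j)).compl₂ j).compr₂ q
  have hX0 : ∀ s, ⁅X, ι (D.inW s)⁆ ∈ 𝓖 0 := fun s => lie_mem hX (h.inW_mem s) (by norm_num)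
  have hF : ∀ s t, ι (D.inW (F s t)) = ⁅⁅X, ι (D.inW s)⁆, ι (D.inW t)⁆ := fun s t =>
    hq _ (lie_mem (hX0 s) (h.inW_mem t) (zero_add _))
  have hF0 : F = 0 := by
    refine D.isCliffordMap.eq_zero_of_symm_of_skew D.symm_B D.nondegenerate_β (F := F)
      (fun s t => h.inW_injective ?_) (fun s v t u => ?_) hx hy hz hxy hxz hyz
    · simp only [hF]
      rw [← sub_eq_zero, ← lie_skew ⁅X, ι (D.inW t)⁆, sub_neg_eq_add, ← leibniz_lie,
        lie_inW_inW, hX']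
    · rw [← oddBracket_apply, ← oddBracket_apply, ← LinearMap.add_apply, ← map_add]
      suffices D.oddBracket (F s t) u + D.oddBracket t (F s u) = 0 by
        rw [this, map_zero, LinearMap.zero_apply]
      apply h.inV_injective
      simp only [map_add, map_zero]
      rw [← lie_inW_inW, ← lie_inW_inW, hF, hF, ← leibniz_lie, lie_inW_inW,
        lie_lie_inV_eq_zero hX']
  refine h.eq_zero_of_lie_inW (by norm_num) hX fun s =>
    h.eq_zero_of_lie_inW (by norm_num) (hX0 s) fun t => ?_
  rw [← hF, hF0]
  simp

theorem eq_zero_of_lie_inV_two (h : IsTransitiveProlongation D.grading 𝓖 ι)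
    (hV : 3 ≤ Module.finrank K V) {X : g} (hX : X ∈ 𝓖 2) (hX' : ∀ v, ⁅X, ι (D.inV v)⁆ = 0) :
    X = 0 := by
  have : Nontrivial V := Module.nontrivial_of_finrank_pos (R := K) (by lia)
  exact h.eq_zero_of_lie_inW (by norm_num) hX fun s => h.eq_zero_of_lie_inV_one hV
    (lie_mem hX (h.inW_mem s) (by norm_num)) (lie_lie_inV_eq_zero hX' s)

theorem eq_zero_of_mem_three [Nontrivial W] (h : IsTransitiveProlongation D.grading 𝓖 ι)
    (hV : 3 ≤ Module.finrank K V) {X : g} (hX : X ∈ 𝓖 3) : X = 0 := by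
  have : Nontrivial V := Module.nontrivial_of_finrank_pos (R := K) (by lia)
  obtain ⟨x, y, z, hx, hy, hz, hxy, hxz, hyz⟩ := exists_orthogonal_triple D.nondegenerate_B D.symm_B hV
  have hX1 : ∀ v, ⁅X, ι (D.inV v)⁆ ∈ 𝓖 1 := fun v => lie_mem hX (h.inV_mem v) (by norm_num)
  choose f hf using fun v => h.exists_lie_inV_eq (hX1 v)
  -- As `V` is abelian, `[[X, u], v]` is symmetric in `u` and `v`, that is, `v · f(u) = u · f(v)`.
  have hf0 : ∀ v, f v = 0 := by
    refine D.isCliffordMap.eq_zero_of_apply_comm D.symm_B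
      (fun u v => h.inW_injective ?_) hx hy hz hxy hxz hyz
    simp only [← hf]
    rw [lie_lie, lie_inV_right, lie_zero, zero_sub, lie_skew]
  have hX0 : ∀ v, ⁅X, ι (D.inV v)⁆ = 0 := fun v => h.eq_zero_of_lie_inV_one hV (hX1 v) fun u => by
    rw [hf, hf0, map_zero, map_zero, map_zero]
  exact h.eq_zero_of_lie_inW (by norm_num) hX fun s => h.eq_zero_of_lie_inV_two hV
    (lie_mem hX (h.inW_mem s) (by norm_num)) (lie_lie_inV_eq_zero hX0 s)

/-- If a component of nonnegative degree vanishes, then so do all the following components. -/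
theorem eq_bot_of_le [Nontrivial V] (h : IsTransitiveProlongation D.grading 𝓖 ι) {p : ℤ}
    (hp : 0 ≤ p) (hp0 : 𝓖 p = ⊥) {r : ℤ} (hr : p ≤ r) : 𝓖 r = ⊥ := by
  induction r, hr using Int.leInduction with
  | base => exact hp0
  | succ r hr ih =>
    refine (Submodule.eq_bot_iff _).mpr fun x hx =>
      h.eq_zero_of_lie_inW (by lia) hx fun s => ?_
    have h1 := lie_mem hx (h.inW_mem s) (show r + 1 + -1 = r by ring)
    rwa [ih, Submodule.mem_bot] at h1

theorem eq_bot_of_three_le [Nontrivial W] (h : IsTransitiveProlongation D.grading 𝓖 ι)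
    (hV : 3 ≤ Module.finrank K V) {p : ℤ} (hp : 3 ≤ p) : 𝓖 p = ⊥ := by
  have : Nontrivial V := Module.nontrivial_of_finrank_pos (R := K) (by lia)
  exact h.eq_bot_of_le (by norm_num)
    ((Submodule.eq_bot_iff _).mpr fun x hx => h.eq_zero_of_mem_three hV hx) hp

/-- Only the degrees from `-2` to `2` survive. Finite dimension is what later allows semisimplicity
to be deduced from a trivial radical. -/
theorem finiteDimensional_g [Nontrivial W] (h : IsTransitiveProlongation D.grading 𝓖 ι)
    (hV : 3 ≤ Module.finrank K V) : FiniteDimensional K g := by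
  have := h.finiteDimensional
  have h1 : (⊤ : Submodule K g) ≤ ⨆ p ∈ Finset.Icc (-2 : ℤ) 2, 𝓖 p := by
    rw [← (DirectSum.Decomposition.isInternal 𝓖).submodule_iSup_eq_top]
    refine iSup_le fun p => ?_
    by_cases hp : p ∈ Finset.Icc (-2 : ℤ) 2
    · exact le_iSup₂_of_le p hp le_rfl
    · suffices 𝓖 p = ⊥ by rw [this]; exact bot_le
      rw [Finset.mem_Icc, not_and_or] at hp
      rcases hp with hp | hp
      · exact h.eq_bot p (by lia)
      · exact h.eq_bot_of_three_le hV (by lia)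
  have h2 : FiniteDimensional K (⨆ p ∈ Finset.Icc (-2 : ℤ) 2, 𝓖 p : Submodule K g) :=
    Finset.sup_eq_iSup (Finset.Icc (-2 : ℤ) 2) 𝓖 ▸ Submodule.finite_finset_sup _ _
  rw [eq_top_iff.mpr h1] at h2
  exact Module.finite_def.mpr (Module.Finite.iff_fg.mp h2)

end IsTransitiveProlongation

end

/-! ### Reflections, graded automorphisms of `m`, and subspaces of `V`. -/

noncomputable section

theorem IsCliffordMap.apply_apply_apply {K V W : Type*} [Field K] [CharZero K] [AddCommGroup V]
    [Module K V] [AddCommGroup W] [Module K W] {B : LinearMap.BilinForm K V}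
    {γ : V →ₗ[K] Module.End K W} (h : IsCliffordMap B γ) (x v : V) (s : W) :
    γ x (γ v (γ x s)) = B x x • γ v s - (2 * B x v) • γ x s := by
  have h1 := h x v (γ x s)
  rw [h.apply_apply_self, map_neg, map_smul, ← sub_eq_add_neg, sub_eq_iff_eq_add] at h1
  rw [h1]
  module

namespace ExtendedTranslationData

variable {K V W : Type*} [Field K] [AddCommGroup V] [Module K V]
  {B : LinearMap.BilinForm K V} [AddCommGroup W] [Module K W]
  [Module (Cl B) W] (D : ExtendedTranslationData W B)

theorem ε_mul_ε : D.ε * D.ε = 1 := by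
  rcases D.symm_or_skew with ⟨h, -⟩ | ⟨h, -⟩ <;> simp [h]

/-- The multiple `v ↦ B(x, x) v - 2 B(x, v) x` of the reflection in `x`. -/
def reflect (B : LinearMap.BilinForm K V) (x : V) : V →ₗ[K] V :=
  B x x • LinearMap.id - (2 : K) • (B x).smulRight x

theorem reflect_apply (x v : V) : reflect B x v = B x x • v - (2 * B x v) • x := by
  simp [reflect, mul_smul]

theorem reflect_reflect (x v : V) : reflect B x (reflect B x v) = (B x x * B x x) • v := by
  simp only [reflect_apply, map_sub, map_smul]
  module

variable [IsScalarTower K (Cl B) W]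

theorem cliffordMulₗ_adjoint (v : V) (s t : W) :
    D.β s (cliffordMulₗ B v t) = D.ε * D.β (cliffordMulₗ B v s) t := by
  have h : D.β (cliffordMulₗ B v s) t = D.ε * D.β s (cliffordMulₗ B v t) :=
    D.cliffordMul_adjoint v s t
  rw [h, ← mul_assoc, D.ε_mul_ε, one_mul]

variable [CharZero K]

theorem cliffordMulₗ_reflect (D : ExtendedTranslationData W B) (x v : V) (s : W) :
    cliffordMulₗ B (reflect B x v) s = cliffordMulₗ B x (cliffordMulₗ B v (cliffordMulₗ B x s)) := by
  have h := D.isCliffordMap.apply_apply_apply x v s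
  rw [h, reflect_apply]
  simp

variable [FiniteDimensional K V]

theorem oddBracket_cliffordMulₗ (x : V) (s t : W) :
    D.oddBracket (cliffordMulₗ B x s) (cliffordMulₗ B x t) =
      D.ε • reflect B x (D.oddBracket s t) := by
  refine D.oddBracket_ext fun v => ?_
  rw [oddBracket_apply, cliffordMulₗ_adjoint, ← D.cliffordMulₗ_reflect, reflect_apply,
    reflect_apply]
  simp only [map_sub, map_smul, LinearMap.sub_apply, LinearMap.smul_apply, smul_eq_mul,
    oddBracket_apply, ← D.symm_B _ x]
  ring

/-- The graded endomorphism of `m(V, W, β)` that acts on `W` as Clifford multiplication by `x`. -/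
def cliffordHom (x : V) : D.Alg →ₗ⁅K⁆ D.Alg :=
  { D.inV.comp ((D.ε • reflect B x).comp D.toV) +
      D.inW.comp ((cliffordMulₗ B x).comp D.toW) with
    map_lie' := by
      intro a b
      simp only [lie_def, LinearMap.add_apply, LinearMap.comp_apply, AddHom.toFun_eq_coe,
        LinearMap.coe_toAddHom, toV_inV, toW_inV, map_zero, add_zero, map_add, toW_inW, zero_add,
        oddBracket_cliffordMulₗ, LinearMap.smul_apply] }

theorem cliffordHom_inV (x v : V) : D.cliffordHom x (D.inV v) = D.inV (D.ε • reflect B x v) := by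
  change D.inV ((D.ε • reflect B x) (D.toV (D.inV v))) +
    D.inW (cliffordMulₗ B x (D.toW (D.inV v))) = _
  simp

theorem cliffordHom_inW (x : V) (s : W) :
    D.cliffordHom x (D.inW s) = D.inW (cliffordMulₗ B x s) := by
  change D.inV ((D.ε • reflect B x) (D.toV (D.inW s))) +
    D.inW (cliffordMulₗ B x (D.toW (D.inW s))) = _
  simp

theorem cliffordHom_cliffordHom (x : V) (m : D.Alg) :
    D.cliffordHom x (D.cliffordHom x m) =
      D.inV ((B x x * B x x) • D.toV m) + D.inW (-(B x x) • D.toW m) := by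
  rw [← D.inV_add_inW m, map_add, map_add, cliffordHom_inV, cliffordHom_inW, cliffordHom_inV,
    cliffordHom_inW]
  have h := D.isCliffordMap.apply_apply_self x (D.toW m)
  rw [h, map_smul (reflect B x), reflect_reflect, smul_smul, D.ε_mul_ε]
  simp

theorem cliffordHom_injective {x : V} (hx : B x x ≠ 0) : Function.Injective (D.cliffordHom x) := by
  refine (injective_iff_map_eq_zero _).mpr fun m hm => ?_
  have h := D.cliffordHom_cliffordHom x m
  rw [hm, map_zero] at h
  have hV : D.toV m = 0 := by simpa [hx] using (congrArg D.toV h).symm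
  have hW : D.toW m = 0 := by simpa [hx] using congrArg D.toW h
  rw [← D.inV_add_inW m, hV, hW, map_zero, map_zero, add_zero]

theorem map_cliffordHom_grading {x : V} (hx : B x x ≠ 0) {p : ℤ} (hp : p = -1 ∨ p = -2) :
    (D.grading p).map (D.cliffordHom x : D.Alg →ₗ[K] D.Alg) = D.grading p := by
  apply le_antisymm
  · rw [Submodule.map_le_iff_le_comap]
    rintro m hm
    rcases hp with rfl | rfl
    · obtain ⟨s, rfl⟩ := hm
      exact ⟨_, (D.cliffordHom_inW x s).symm⟩
    · obtain ⟨s, rfl⟩ := hm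
      exact ⟨_, (D.cliffordHom_inV x s).symm⟩
  · intro m hm
    rcases hp with rfl | rfl
    · obtain ⟨s, rfl⟩ := hm
      refine ⟨D.inW (cliffordMulₗ B x (-(B x x)⁻¹ • s)), D.inW_mem_grading _, ?_⟩
      have h := D.isCliffordMap.apply_apply_self x (-(B x x)⁻¹ • s)
      refine (D.cliffordHom_inW x _).trans ?_
      rw [h]
      simp [smul_smul, hx]
    · obtain ⟨v, rfl⟩ := hm
      refine ⟨D.inV (D.ε • reflect B x ((B x x * B x x)⁻¹ • v)), D.inV_mem_grading _, ?_⟩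
      refine (D.cliffordHom_inV x _).trans ?_
      rw [map_smul (reflect B x), reflect_reflect, smul_smul, smul_smul, D.ε_mul_ε, one_mul,
        smul_smul, mul_inv_cancel₀ (mul_ne_zero hx hx), one_smul]

/-- A nonzero subspace `U` of `V` such that `[U · W, W] ⊆ U` is the whole of `V`. -/
theorem eq_top_of_oddBracket_mem [Nontrivial W] (hV : 3 ≤ Module.finrank K V) {U : Submodule K V}
    (hU : ∀ x ∈ U, ∀ w s : W, D.oddBracket (cliffordMulₗ B x w) s ∈ U) (hU0 : U ≠ ⊥) : U = ⊤ := by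
  obtain ⟨x₀, hx₀, hx₀0⟩ := U.exists_mem_ne_zero_of_ne_bot hU0
  by_contra hUt
  have hfin := LinearMap.BilinForm.finrank_orthogonal D.nondegenerate_B U
  have hlt := Submodule.finrank_lt hUt
  have hne : B.orthogonal U ≠ ⊥ := by
    intro h
    rw [h, finrank_bot] at hfin
    lia
  obtain ⟨u₀, hu₀, hu₀0⟩ := (B.orthogonal U).exists_mem_ne_zero_of_ne_bot hne
  -- Here `β(u · x · w, s) = B([x · w, s], u) = 0` for all `w` and `s`, so `u x` acts as zero and
  -- the two vectors are proportional. Thus `U` and its orthogonal are at most lines, while their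
  -- dimensions add up to at least three.
  have key : ∀ x ∈ U, ∀ u ∈ B.orthogonal U, ∀ z, B u z • x = B x z • u := by
    intro x hx u hu z
    refine D.isCliffordMap.smul_eq_smul_of_comp_eq_zero D.nondegenerate_B
      (fun w => D.nondegenerate_β.1 _ fun s => ?_) z
    rw [← oddBracket_apply]
    exact hu _ (hU x hx w s)
  have exists_ne : ∀ {v : V}, v ≠ 0 → ∃ z, B v z ≠ 0 := fun hv => by
    by_contra! h
    exact hv (D.nondegenerate_B.1 _ h)
  have h1 : U ≤ K ∙ u₀ := by
    intro x hx
    obtain ⟨z, hz⟩ := exists_ne hu₀0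
    refine Submodule.mem_span_singleton.mpr ⟨(B u₀ z)⁻¹ * B x z, ?_⟩
    rw [mul_smul, ← key x hx u₀ hu₀ z, smul_smul, inv_mul_cancel₀ hz, one_smul]
  have h2 : B.orthogonal U ≤ K ∙ x₀ := by
    intro u hu
    obtain ⟨z, hz⟩ := exists_ne hx₀0
    refine Submodule.mem_span_singleton.mpr ⟨(B x₀ z)⁻¹ * B u z, ?_⟩
    rw [mul_smul, key x₀ hx₀ u hu z, smul_smul, inv_mul_cancel₀ hz, one_smul]
  have h3 := (Submodule.finrank_mono h1).trans (finrank_span_singleton hu₀0).le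
  have h4 := (Submodule.finrank_mono h2).trans (finrank_span_singleton hx₀0).le
  lia

end ExtendedTranslationData

/-! ### Ideals and simplicity. -/

namespace IsTransitiveProlongation

open ExtendedTranslationData GradedLieAlgebra

variable {K V W g : Type*} [Field K] [CharZero K] [AddCommGroup V] [Module K V]
  [FiniteDimensional K V] {B : LinearMap.BilinForm K V} [AddCommGroup W] [Module K W]
  [Module (Cl B) W] [IsScalarTower K (Cl B) W] {D : ExtendedTranslationData W B}
  [LieRing g] [LieAlgebra K g] {𝓖 : ℤ → Submodule K g} [GradedLieAlgebra 𝓖]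
  {ι : D.Alg →ₗ⁅K⁆ g}

/-- The same graded algebra with a twisted identification of `m`: a second prolongation to which
maximality can be applied. -/
theorem comp_cliffordHom (h : IsTransitiveProlongation D.grading 𝓖 ι) {x : V} (hx : B x x ≠ 0) :
    IsTransitiveProlongation D.grading 𝓖 (ι.comp (D.cliffordHom x)) where
  finiteDimensional := h.finiteDimensional
  injective := h.injective.comp (D.cliffordHom_injective hx)
  map_neg_one := by
    rw [← h.map_neg_one]
    nth_rw 2 [← D.map_cliffordHom_grading hx (Or.inl rfl)]
    exact Submodule.map_comp _ _ _
  map_neg_two := by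
    rw [← h.map_neg_two]
    nth_rw 2 [← D.map_cliffordHom_grading hx (Or.inr rfl)]
    exact Submodule.map_comp _ _ _
  eq_bot := h.eq_bot
  transitive := h.transitive

variable (ι 𝓖) in
/-- The space of all `w ∈ W` such that `v ↦ v · w` is the action on `V` of an element of `g₁`. -/
def spinorSubmodule : Submodule K W where
  carrier := {w | ∃ X ∈ 𝓖 1, ∀ v, ⁅X, ι (D.inV v)⁆ = ι (D.inW (cliffordMulₗ B v w))}
  add_mem' := by
    rintro w w' ⟨X, hX, hw⟩ ⟨X', hX', hw'⟩
    exact ⟨X + X', add_mem hX hX', fun v => by simp only [add_lie, hw, hw', map_add]⟩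
  zero_mem' := ⟨0, zero_mem _, fun v => by simp⟩
  smul_mem' := by
    rintro c w ⟨X, hX, hw⟩
    exact ⟨c • X, Submodule.smul_mem _ _ hX, fun v => by simp only [smul_lie, hw, map_smul]⟩

/-- A nonzero ideal meets `V`. -/
theorem exists_inV_mem_of_sum_mem [Nontrivial V] (h : IsTransitiveProlongation D.grading 𝓖 ι)
    (I : LieIdeal K g) (n : ℕ) (y : ℕ → g) (hy : ∀ k : ℕ, y k ∈ 𝓖 ((k : ℤ) - 2)) (hn : y n ≠ 0)
    (hI : ∑ k ∈ Finset.range (n + 1), y k ∈ I) : ∃ v, v ≠ 0 ∧ ι (D.inV v) ∈ I := by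
  induction n generalizing y with
  | zero =>
    obtain ⟨v, hv⟩ := h.exists_inV (hy 0)
    refine ⟨v, ?_, by simpa [hv] using hI⟩
    rintro rfl
    exact hn (by rw [← hv, map_zero, map_zero])
  | succ n ih =>
    -- Bracketing with `t` lowers degrees by one and keeps the top component nonzero. The component
    -- of degree `-2` drops out, so the sum loses one term.
    obtain ⟨t, ht⟩ : ∃ t, ⁅y (n + 1), ι (D.inW t)⁆ ≠ 0 := by
      by_contra! h0
      exact hn (h.eq_zero_of_lie_inW (by push_cast; lia) (hy (n + 1)) h0)
    have hy' : ∀ k : ℕ, ⁅y k, ι (D.inW t)⁆ ∈ 𝓖 ((k : ℤ) - 3) := fun k =>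
      lie_mem (hy k) (h.inW_mem t) (by ring)
    refine ih (fun k => ⁅y (k + 1), ι (D.inW t)⁆) (fun k => ?_) ht ?_
    · have := hy' (k + 1)
      rwa [show ((k + 1 : ℕ) : ℤ) - 3 = k - 2 by push_cast; ring] at this
    · have h0 : ⁅y 0, ι (D.inW t)⁆ = 0 := by
        have := hy' 0
        rwa [h.eq_bot _ (by norm_num), Submodule.mem_bot] at this
      have h1 := lie_mem_left K g I _ (ι (D.inW t)) hI
      rwa [sum_lie, Finset.sum_range_succ', h0, add_zero] at h1

theorem exists_inV_mem [Nontrivial W] (h : IsTransitiveProlongation D.grading 𝓖 ι)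
    (hV : 3 ≤ Module.finrank K V) {I : LieIdeal K g} (hI : I ≠ ⊥) :
    ∃ v, v ≠ 0 ∧ ι (D.inV v) ∈ I := by
  classical
  have : Nontrivial V := Module.nontrivial_of_finrank_pos (R := K) (by lia)
  obtain ⟨x, hx, hx0⟩ := I.toSubmodule.exists_mem_ne_zero_of_ne_bot (by simpa using hI)
  let y : ℕ → g := fun k => DirectSum.decompose 𝓖 x ((k : ℤ) - 2)
  have hy : ∑ k ∈ Finset.range 5, y k = x := by
    conv_rhs => rw [← DirectSum.sum_support_decompose 𝓖 x]
    rw [← Finset.sum_image (s := Finset.range 5) (g := fun k : ℕ => (k : ℤ) - 2)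
      (f := fun p : ℤ => (DirectSum.decompose 𝓖 x p : g)) (by intro a _ b _; simp)]
    refine (Finset.sum_subset (fun p hp => ?_) fun p _ hp => ?_).symm
    · have hp0 : 𝓖 p ≠ ⊥ := fun h0 => by
        exact DFinsupp.mem_support_iff.mp hp
          (Subtype.ext ((Submodule.eq_bot_iff _).mp h0 _ (SetLike.coe_mem _)))
      have h1 : -2 ≤ p := by
        by_contra! h1
        exact hp0 (h.eq_bot p h1)
      have h2 : p < 3 := by
        by_contra! h1
        exact hp0 (h.eq_bot_of_three_le hV h1)
      exact Finset.mem_image.mpr ⟨(p + 2).toNat, Finset.mem_range.mpr (by lia), by lia⟩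
    · rw [DFinsupp.notMem_support_iff.mp hp]
      rfl
  -- Discards vanishing top components until the last one is nonzero.
  have key : ∀ N : ℕ, ∑ k ∈ Finset.range N, y k ∈ I → ∑ k ∈ Finset.range N, y k ≠ 0 →
      ∃ v, v ≠ 0 ∧ ι (D.inV v) ∈ I := by
    intro N
    induction N with
    | zero => simp
    | succ N ih =>
      intro h1 h2
      by_cases hN : y N = 0
      · rw [Finset.sum_range_succ, hN, add_zero] at h1 h2
        exact ih h1 h2
      · exact h.exists_inV_mem_of_sum_mem I N y (fun k => SetLike.coe_mem _) hN h1
  exact key 5 (by rwa [hy]) (by rwa [hy])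

/-- If every element of `W` comes from `g₁`, then every nonzero ideal contains `V`. -/
theorem inV_mem_ideal [Nontrivial W] (h : IsTransitiveProlongation D.grading 𝓖 ι)
    (hV : 3 ≤ Module.finrank K V) (hS : spinorSubmodule 𝓖 ι = ⊤) {I : LieIdeal K g}
    (hI : I ≠ ⊥) (v : V) : ι (D.inV v) ∈ I := by
  have hU : I.toSubmodule.comap ((ι : D.Alg →ₗ[K] g).comp D.inV) = ⊤ := by
    refine D.eq_top_of_oddBracket_mem hV (fun x hx w s => ?_) ?_
    · obtain ⟨X, -, hw⟩ : w ∈ spinorSubmodule 𝓖 ι := hS ▸ Submodule.mem_top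
      have h1 := lie_mem_left K g I _ (ι (D.inW s)) (lie_mem_right K g I X _ hx)
      change ⁅⁅X, ι (D.inV x)⁆, _⁆ ∈ I at h1
      rwa [hw, lie_inW_inW] at h1
    · obtain ⟨x, hx, hxI⟩ := h.exists_inV_mem hV hI
      exact (Submodule.ne_bot_iff _).mpr ⟨x, hxI, hx⟩
  exact (hU ▸ Submodule.mem_top : v ∈ I.toSubmodule.comap ((ι : D.Alg →ₗ[K] g).comp D.inV))

/-- For `x` anisotropic, every `s` is `x · w` for some `w`, hence `[X, x]` for the `X ∈ g₁` attached
to `w`, and `x` is already in the ideal. -/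
theorem inW_mem_ideal [Nontrivial W] (h : IsTransitiveProlongation D.grading 𝓖 ι)
    (hV : 3 ≤ Module.finrank K V) (hS : spinorSubmodule 𝓖 ι = ⊤) {I : LieIdeal K g}
    (hI : I ≠ ⊥) (s : W) : ι (D.inW s) ∈ I := by
  obtain ⟨x, _, _, hx, _⟩ := exists_orthogonal_triple D.nondegenerate_B D.symm_B hV
  obtain ⟨X, -, hw⟩ : cliffordMulₗ B x (-(B x x)⁻¹ • s) ∈ spinorSubmodule 𝓖 ι :=
    hS ▸ Submodule.mem_top
  have h1 := lie_mem_right K g I X _ (h.inV_mem_ideal hV hS hI x)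
  have h2 := D.isCliffordMap.apply_apply_self x (-(B x x)⁻¹ • s)
  rw [hw, h2] at h1
  simpa [smul_smul, hx] using h1

theorem exists_lie_inW_ne_zero [Nontrivial W] [Nontrivial V]
    (h : IsTransitiveProlongation D.grading 𝓖 ι) :
    ∃ s t, ⁅ι (D.inW s), ι (D.inW t)⁆ ≠ 0 := by
  obtain ⟨s, hs⟩ := exists_ne (0 : W)
  by_contra! h0
  exact hs (h.inW_injective (by
    simpa using h.eq_zero_of_lie_inW le_rfl (h.inW_mem s) (h0 s)))

/-- If every element of `W` comes from `g₁`, then `g` is simple. -/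
theorem isSimple [Nontrivial W] (h : IsTransitiveProlongation D.grading 𝓖 ι)
    (hV : 3 ≤ Module.finrank K V) (hS : spinorSubmodule 𝓖 ι = ⊤) : LieAlgebra.IsSimple K g := by
  have : Nontrivial V := Module.nontrivial_of_finrank_pos (R := K) (by lia)
  have := h.finiteDimensional_g hV
  obtain ⟨s, t, hst⟩ := h.exists_lie_inW_ne_zero
  have : LieAlgebra.HasTrivialRadical K g := by
    rw [LieAlgebra.hasTrivialRadical_iff_no_abelian_ideals]
    intro I hI
    by_contra hI0
    have h1 := hI.trivial ⟨_, h.inW_mem_ideal hV hS hI0 s⟩ ⟨_, h.inW_mem_ideal hV hS hI0 t⟩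
    exact hst (congrArg Subtype.val h1)
  -- A semisimple algebra is the sum of its minimal ideals. Distinct ones meet in zero, yet all
  -- contain `V`, so there is only one.
  have htop : ∀ I : LieIdeal K g, IsAtom I → I = ⊤ := by
    intro I hI
    rw [← LieAlgebra.IsSemisimple.sSup_atoms_eq_top (R := K) (L := g)]
    refine le_antisymm (le_sSup hI) (sSup_le fun J hJ => ?_)
    by_contra hJI
    have h1 : J ⊓ I = ⊥ := (hJ.disjoint_of_ne hI fun h => hJI h.le).eq_bot
    obtain ⟨v, hv⟩ := exists_ne (0 : V)
    have h2 : ι (D.inV v) ∈ J ⊓ I :=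
      ⟨h.inV_mem_ideal hV hS hJ.1 v, h.inV_mem_ideal hV hS hI.1 v⟩
    rw [h1, LieSubmodule.mem_bot] at h2
    exact hv (h.inV_injective (by simpa using h2))
  refine ⟨fun I => ?_, fun hab => hst (hab.trivial _ _)⟩
  rw [or_iff_not_imp_left]
  intro hI
  obtain ⟨J, hJ, hJI⟩ := (eq_bot_or_exists_atom_le I).resolve_left hI
  exact top_le_iff.mp (htop J hJ ▸ hJI)

/-- If the components of positive degree vanish, then `V` is a proper ideal. -/
theorem not_isSimple [Nontrivial W] [Nontrivial V] (h : IsTransitiveProlongation D.grading 𝓖 ι)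
    (h0 : ∀ p : ℤ, 1 ≤ p → 𝓖 p = ⊥) : ¬ LieAlgebra.IsSimple K g := by
  intro hsimple
  let I : LieIdeal K g :=
    { 𝓖 (-2) with
      lie_mem := by
        intro x m hm
        have hx : x ∈ ⨆ p, 𝓖 p :=
          (DirectSum.Decomposition.isInternal 𝓖).submodule_iSup_eq_top ▸ Submodule.mem_top
        change ⁅x, m⁆ ∈ 𝓖 (-2)
        induction hx using Submodule.iSup_induction' with
        | mem p x hx =>
          have hxm := GradedLieAlgebra.lie_mem hx hm rfl
          -- Negative degrees send `g₋₂` below the bottom, degree zero preserves it, and positive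
          -- degrees are absent.
          rcases lt_trichotomy p 0 with hp | rfl | hp
          · rw [h.eq_bot _ (by lia), Submodule.mem_bot] at hxm
            rw [hxm]
            exact zero_mem _
          · simpa using hxm
          · rw [h0 p hp, Submodule.mem_bot] at hx
            rw [hx, zero_lie]
            exact zero_mem _
        | zero => rw [zero_lie]; exact zero_mem _
        | add x y _ _ hx hy => rw [add_lie]; exact add_mem hx hy }
  have hmem : ∀ x, x ∈ I ↔ x ∈ 𝓖 (-2) := fun x => Iff.rfl
  obtain ⟨v, hv⟩ := exists_ne (0 : V)
  obtain ⟨s, t, hst⟩ := h.exists_lie_inW_ne_zero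
  rcases hsimple.eq_bot_or_eq_top I with hI | hI
  · have h1 := (hmem _).mpr (h.inV_mem v)
    rw [hI, LieSubmodule.mem_bot] at h1
    exact hv (h.inV_injective (by simpa using h1))
  · obtain ⟨v, hv⟩ := h.exists_inV ((hmem (ι (D.inW s))).mp (hI ▸ LieSubmodule.mem_top _))
    rw [← hv, lie_inV] at hst
    exact hst rfl

end IsTransitiveProlongation

/-! ### Maximality makes the space of spinors a Clifford submodule. -/

namespace IsMaximalTransitiveProlongation

open ExtendedTranslationData IsTransitiveProlongation

variable {K : Type*} [Field K] [CharZero K] {V W g : Type u} [AddCommGroup V] [Module K V]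
  [FiniteDimensional K V] {B : LinearMap.BilinForm K V} [AddCommGroup W] [Module K W]
  [Module (Cl B) W] [IsScalarTower K (Cl B) W] {D : ExtendedTranslationData W B}
  [LieRing g] [LieAlgebra K g] {𝓖 : ℤ → Submodule K g} [GradedLieAlgebra 𝓖]
  {ι : D.Alg →ₗ⁅K⁆ g}

theorem cliffordMulₗ_mem_of_anisotropic (h : IsMaximalTransitiveProlongation D.grading 𝓖 ι)
    {x : V} (hx : B x x ≠ 0) {w : W} (hw : w ∈ spinorSubmodule 𝓖 ι) :
    cliffordMulₗ B x w ∈ spinorSubmodule 𝓖 ι := by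
  obtain ⟨φ, -, hφ, hφι⟩ := h.maximal g 𝓖 (ι.comp (D.cliffordHom x))
    (h.toIsTransitiveProlongation.comp_cliffordHom hx)
  obtain ⟨X, hX, hXw⟩ := hw
  -- On `m`, `φ` inverts `cliffordHom x`. So `[φ X, v]` is `φ` of `ε` times `x · v · x · w`, that
  -- is, `ε v · (x · w)`, and the factor `ε` cancels since `ε² = 1`.
  refine ⟨D.ε • φ X, Submodule.smul_mem _ _ (hφ 1 X hX), fun v => ?_⟩
  have hV : ι (D.inV v) = φ (ι (D.inV (D.ε • reflect B x v))) := by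
    rw [← cliffordHom_inV]
    exact (hφι _).symm
  have hW : ∀ s, φ (ι (D.inW (cliffordMulₗ B x s))) = ι (D.inW s) := fun s => by
    rw [← cliffordHom_inW]
    exact hφι _
  rw [hV, smul_lie, ← LieHom.map_lie, hXw, map_smul, LinearMap.smul_apply, map_smul, map_smul,
    map_smul, smul_smul, D.ε_mul_ε, one_smul, D.cliffordMulₗ_reflect, hW]

/-- Isotropic vectors give no automorphism, but anisotropic ones span `V`. -/
theorem cliffordMulₗ_mem (h : IsMaximalTransitiveProlongation D.grading 𝓖 ι)
    (v : V) {w : W} (hw : w ∈ spinorSubmodule 𝓖 ι) :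
    cliffordMulₗ B v w ∈ spinorSubmodule 𝓖 ι := by
  obtain ⟨e, -, he⟩ := exists_orthogonal_basis_anisotropic D.nondegenerate_B D.symm_B
  rw [← e.sum_repr v]
  simp only [map_sum, map_smul, LinearMap.sum_apply, LinearMap.smul_apply]
  exact sum_mem fun i _ => Submodule.smul_mem _ _ (h.cliffordMulₗ_mem_of_anisotropic (he i) hw)

theorem smul_mem (h : IsMaximalTransitiveProlongation D.grading 𝓖 ι) (a : Cl B) {w : W}
    (hw : w ∈ spinorSubmodule 𝓖 ι) : a • w ∈ spinorSubmodule 𝓖 ι := by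
  induction a using CliffordAlgebra.induction generalizing w with
  | algebraMap r =>
    rw [algebraMap_smul]
    exact Submodule.smul_mem _ r hw
  | ι v => exact h.cliffordMulₗ_mem v hw
  | mul a b ha hb =>
    rw [mul_smul]
    exact ha (hb hw)
  | add a b ha hb =>
    rw [add_smul]
    exact add_mem (ha hw) (hb hw)

theorem spinorSubmodule_eq_top (h : IsMaximalTransitiveProlongation D.grading 𝓖 ι)
    (hV : 3 ≤ Module.finrank K V) [IsSimpleModule (Cl B) W] (h1 : 𝓖 1 ≠ ⊥) :
    spinorSubmodule 𝓖 ι = ⊤ := by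
  have : Nontrivial V := Module.nontrivial_of_finrank_pos (R := K) (by lia)
  have : Nontrivial W := IsSimpleModule.nontrivial (Cl B) W
  let S : Submodule (Cl B) W :=
    { (spinorSubmodule 𝓖 ι).toAddSubmonoid with smul_mem' := fun a _ hw => h.smul_mem a hw }
  have hS : ∀ w, w ∈ S ↔ w ∈ spinorSubmodule 𝓖 ι := fun w => Iff.rfl
  rcases eq_bot_or_eq_top S with hbot | htop
  · obtain ⟨X, hX, hX0⟩ := (𝓖 1).exists_mem_ne_zero_of_ne_bot h1
    obtain ⟨w, hw⟩ := h.exists_lie_inV_eq hX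
    have hw0 : w ∈ S := ⟨X, hX, hw⟩
    rw [hbot, Submodule.mem_bot] at hw0
    exact absurd (h.eq_zero_of_lie_inV_one hV hX fun v => by
      rw [hw, hw0, map_zero, map_zero, map_zero]) hX0
  · exact eq_top_iff.mpr fun w _ => (hS w).mp (htop ▸ Submodule.mem_top)

end IsMaximalTransitiveProlongation

end

theorem theorem2p5 {K : Type*} [RCLike K] {V W g : Type u}
    [AddCommGroup V] [Module K V] [FiniteDimensional K V] (B : LinearMap.BilinForm K V)
    [AddCommGroup W] [Module K W] [Module (Cl B) W] [IsScalarTower K (Cl B) W]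
    (D : ExtendedTranslationData W B)
    [LieRing g] [LieAlgebra K g] (𝓖 : ℤ → Submodule K g) [GradedLieAlgebra 𝓖]
    (ι : D.Alg →ₗ⁅K⁆ g) (hg : IsMaximalTransitiveProlongation D.grading 𝓖 ι)
    (hV : 3 ≤ Module.finrank K V) (hW : IsSimpleModule (Cl B) W) :
    Xor (∀ p : ℤ, 1 ≤ p → 𝓖 p = ⊥) (LieAlgebra.IsSimple K g) := by
  have : Nontrivial V := Module.nontrivial_of_finrank_pos (R := K) (by lia)
  have : Nontrivial W := IsSimpleModule.nontrivial (Cl B) W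
  have h := hg.toIsTransitiveProlongation
  -- The degree-one component alone decides between the two cases.
  by_cases h1 : 𝓖 1 = ⊥
  · have h0 : ∀ p : ℤ, 1 ≤ p → 𝓖 p = ⊥ := fun p hp => h.eq_bot_of_le zero_le_one h1 hp
    exact Or.inl ⟨h0, h.not_isSimple h0⟩
  · exact Or.inr ⟨h.isSimple hV (hg.spinorSubmodule_eq_top hV h1), fun h0 => h1 (h0 1 le_rfl)⟩
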